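/- Let $q \ge 2$ and let $F$ be the free group on $\bar y_1, \dots, \bar y_q$. In any group put $[u,v] = u^{-1}v^{-1}uv$, and let $\gamma_1(G) = G$, $\gamma_{i+1}(G) = [\gamma_i(G), G]$ be the lower central series. Let $C$ be the set of formal expressions built from symbols $x_1, \dots, x_q$ by a binary operation $[u,v]$; the weight $\mathrm{wt}(u)$ of $u \in C$ is the total number of occurrences of symbols in $u$. For $A \subseteq C$ and $b \in C$ let $A * b$ be the set of all $[\dots[[a,b],b]\dots,b]$ with $k \ge 0$ entries $b$, where $a \in A$ and $a \ne b$. A *basic sequence* is a sequence $b_1, b_2, \dots$ in $C$ such that, with $X_0 = \{x_1, \dots, x_q\}$ and $X_k = X_{k-1} * b_k$ for $k \ge 1$, each $b_k$ is an element of least possible weight in $X_{k-1}$. For elements $y_1, \dots, y_q$ of a group, the basic sequence determines the basic commutators $c_1, c_2, \dots$ in the $y_i$: $c_j$ is obtained from $b_j$ by replacing every $x_i$ by $y_i$ and reading $[u,v]$ as $u^{-1}v^{-1}uv$. Write $\bar c_j$ for those in the $\bar y_i \in F$. **Theorem.** Let $n$ be a positive integer, $R = \mathbb{Z}\langle x_1,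 \dots, x_q\rangle$ the free associative ring with unit, $\mathfrak{k}$ the ideal of elements of $R$ with zero constant term, and $H$ the subgroup of the group of units of $R/\mathfrak{k}^n$ generated by $y_i = 1 + x_i$, $i = 1, \dots, q$. Then there is an isomorphism $F/\gamma_n(F) \cong H$ that maps $\bar y_i\gamma_n(F)$ to $y_i$ for every $i$. Moreover, for every basic sequence, the terms of weight less than $n$ are exactly $b_1, \dots, b_N$ for some finite $N \ge 0$; every element of $H$ is uniquely of the form $c_1^{\mu_1} c_2^{\mu_2} \cdots c_N^{\mu_N}$ with integers $\mu_1, \dots, \mu_N$, where $c_j$ are the basic commutators in $y_1, \dots, y_q$; and every element of $F/\gamma_n(F)$ is uniquely of the form $\bar c_1^{\mu_1} \cdots \bar c_N^{\mu_N}\gamma_n(F)$ with integers $\mu_1, \dots, \mu_N$. **Corollary.** For every basic sequence and every $w > 0$, $\gamma_w(F)/\gamma_{w+1}(F)$ is a free abelian group, with basis represented by those $\bar c_j$ for which $b_j$ has weight $w$. -/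

import Mathlib

namespace BasicComm

/-- Formal expressions in symbols `x_a` (`a : α`) under a formal binary operation `[u, v]` are the
elements `u * v` of the free magma on `α`; the weight of an expression is `FreeMagma.length`.
`star A b` is the set of all `[…[[a, b], b]…, b]` (`k ≥ 0` times `b`) with `a ∈ A`, `a ≠ b`. -/
def star {α : Type*} (A : Set (FreeMagma α)) (b : FreeMagma α) : Set (FreeMagma α) :=
  {u | ∃ a ∈ A, a ≠ b ∧ ∃ k : ℕ, u = (fun c => c * b)^[k] a}

/-- The sets `X_0 = {x_a}`, `X_{k+1} = X_k * b_{k+1}`, where the sequence `b_1, b_2, …` is indexed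
from zero, i.e. `b k` is the term `b_{k+1}`. -/
def stage {α : Type*} (b : ℕ → FreeMagma α) : ℕ → Set (FreeMagma α)
  | 0 => Set.range FreeMagma.of
  | k + 1 => star (stage b k) (b k)

/-- A basic sequence: each term is an arbitrary element of least possible weight in the current
set. In particular the weights are nondecreasing, see `IsBasicSequence.monotone_length`. -/
structure IsBasicSequence {α : Type*} (b : ℕ → FreeMagma α) : Prop where
  mem_stage : ∀ k, b k ∈ stage b k
  length_le : ∀ k, ∀ u ∈ stage b k, (b k).length ≤ u.length

theorem IsBasicSequence.monotone_length {α : Type*} {b : ℕ → FreeMagma α}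
    (hb : IsBasicSequence b) : Monotone fun k => (b k).length := by
  refine monotone_nat_of_le_succ fun k => ?_
  obtain ⟨a, ha, -, m, hm⟩ := hb.mem_stage (k + 1)
  refine (hb.length_le k a ha).trans ?_
  rw [hm]
  clear hm
  induction m with
  | zero => exact le_rfl
  | succ m ih =>
    rw [Function.iterate_succ_apply']
    exact ih.trans (Nat.le_add_right _ _)

/-- The value in a group of a formal expression, for given values of the symbols, where `[u, v]`
is interpreted as `u⁻¹ v⁻¹ u v`. -/
def value {α G : Type*} [Group G] (y : α → G) : FreeMagma α → G
  | .of a => y a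
  | .mul u v => (value y u)⁻¹ * (value y v)⁻¹ * value y u * value y v

/-- The ordered product `g_1 ^ μ_1 * g_2 ^ μ_2 * ⋯ * g_N ^ μ_N`. -/
def powProd {G : Type*} [Group G] (g : ℕ → G) {N : ℕ} (μ : Fin N → ℤ) : G :=
  (List.ofFn fun j : Fin N => g j ^ μ j).prod

/-- The lower central series with the indexing `γ_1(G) = G`, `γ_{n+1}(G) = [γ_n(G), G]`
(and the irrelevant value `γ_0(G) = G`). -/
def gamma (G : Type*) [Group G] (n : ℕ) : Subgroup G :=
  (⊤ : Subgroup G).lowerCentralSeries (n - 1)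

instance gamma_normal (G : Type*) [Group G] (n : ℕ) : (gamma G n).Normal := by
  unfold gamma; infer_instance

/-- The quotient `γ_w(G) / γ_{w+1}(G)`. -/
abbrev GammaQuot (G : Type*) [Group G] (w : ℕ) : Type _ :=
  gamma G w ⧸ (gamma G (w + 1)).subgroupOf (gamma G w)

instance gammaQuotCommGroup (G : Type*) [Group G] (w : ℕ) : CommGroup (GammaQuot G w) where
  mul_comm := by
    intro x y
    induction x using QuotientGroup.induction_on with | H x =>
    induction y using QuotientGroup.induction_on with | H y =>
    rw [← QuotientGroup.mk_mul, ← QuotientGroup.mk_mul, QuotientGroup.eq,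
      Subgroup.mem_subgroupOf]
    rcases w with _ | w
    · simp [gamma]
    · have h : (y : G)⁻¹ * (x : G)⁻¹ * (y : G)⁻¹⁻¹ * (x : G)⁻¹⁻¹ ∈ gamma G (w + 1 + 1) :=
        Subgroup.commutator_mem_commutator (H₁ := gamma G (w + 1)) (H₂ := ⊤)
          (inv_mem y.2) (Subgroup.mem_top _)
      simpa [mul_assoc] using h

/-- The ideal `𝔨 = R_1 + R_2 + ⋯` of the free associative ring `R = ℤ⟨x_1, …, x_q⟩`: the elements
with constant term zero. -/
def augIdeal (q : ℕ) : Ideal (FreeAlgebra ℤ (Fin q)) :=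
  RingHom.ker (FreeAlgebra.algebraMapInv (R := ℤ) (X := Fin q))

instance augIdeal_isTwoSided (q : ℕ) : (augIdeal q).IsTwoSided := by
  unfold augIdeal; infer_instance

/-- The truncated free associative ring `U = R / 𝔨 ^ n`. -/
abbrev TruncRing (q n : ℕ) : Type := FreeAlgebra ℤ (Fin q) ⧸ augIdeal q ^ n

/-- The image of `x_i` in `R / 𝔨 ^ n`. -/
def truncVar (q n : ℕ) (i : Fin q) : TruncRing q n :=
  Ideal.Quotient.mk (augIdeal q ^ n) (FreeAlgebra.ι ℤ i)

theorem isUnit_one_add_truncVar (q n : ℕ) (i : Fin q) : IsUnit (1 + truncVar q n i) := by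
  refine IsNilpotent.isUnit_one_add ⟨n, ?_⟩
  rw [truncVar, ← map_pow, Ideal.Quotient.eq_zero_iff_mem]
  refine Ideal.pow_mem_pow ?_ n
  simp [augIdeal, RingHom.mem_ker, FreeAlgebra.algebraMapInv]

/-- The unit `y_i = 1 + x_i` of `R / 𝔨 ^ n`. -/
noncomputable def truncUnit (q n : ℕ) (i : Fin q) : (TruncRing q n)ˣ :=
  (isUnit_one_add_truncVar q n i).unit

/-- The subgroup `H` of the units of `R / 𝔨 ^ n` generated by `y_1, …, y_q`. -/
noncomputable def truncGroup (q n : ℕ) : Subgroup (TruncRing q n)ˣ :=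
  Subgroup.closure (Set.range (truncUnit q n))

/-- The generator `y_i` as an element of `H`. -/
noncomputable def truncGen (q n : ℕ) (i : Fin q) : truncGroup q n :=
  ⟨truncUnit q n i, Subgroup.subset_closure (Set.mem_range_self i)⟩

end BasicComm

/-! Existence of the normal form is collection. Let `G` be a group in which expressions of weight at
least `n` have value 1, such as `F / γ_n(F)`, and let `K_k` be the subgroup generated by the values
of `stage b k`. The value `c_k` of `b k` normalizes `K_{k+1}`, so `K_k = ⟨c_k⟩ K_{k+1}`. Splitting
off one factor after another leaves a remainder in `K_N`, which is trivial once `b N` has weight at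
least `n` (`IsBasicSequence.exists_eq_powProd`).

Uniqueness compares leading terms in `R / 𝔨 ^ n`. With `y_i = 1 + x_i`, the leading term of `c_j -
1` is the Lie element obtained by reading `[u, v]` as `uv - vu`
(`IsMulFiltration.value_sub_one_sub_lieValue_mem`). Hence modulo `𝔨 ^ (w + 1)` two products whose
exponents agree below weight `w` differ by the sum of `(μ_j - ν_j)` times the Lie elements of weight
`w` (`magnusHom_powProd_eq_add_sum`). These are linearly independent by Lazard elimination: the Lie
elements of each stage freely generate a subring (`lift_lieValue_stage_injective`), and all terms of
weight `w` lie in one stage. Induction on `w` identifies the exponents.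

The kernel of `F → H` contains `γ_n(F)` because commutators add filtration degrees. Conversely, an
element of the kernel has a normal form modulo `γ_n(F)`, and uniqueness makes its exponents zero.
For the corollary, `g ↦ g - 1` carries the independence to `γ_w / γ_{w+1}`, and the normal form
modulo `γ_{w+1}` gives spanning. -/

namespace BasicComm

/-! ### Combinatorics of basic sequences -/

section Sequences

variable {α : Type*} {b : ℕ → FreeMagma α}

theorem mem_stage_succ_cases {k : ℕ} {u : FreeMagma α} (hu : u ∈ stage b (k + 1)) :
    (u ∈ stage b k ∧ u ≠ b k) ∨ (b k).length < u.length := by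
  obtain ⟨a, ha, hne, m, rfl⟩ := hu
  cases m with
  | zero => exact Or.inl ⟨ha, hne⟩
  | succ m =>
    right
    rw [Function.iterate_succ_apply']
    exact Nat.lt_add_of_pos_left (FreeMagma.length_pos _)

theorem mem_stage_succ_of_ne {k : ℕ} {u : FreeMagma α} (hu : u ∈ stage b k) (hne : u ≠ b k) :
    u ∈ stage b (k + 1) :=
  ⟨u, hu, hne, 0, rfl⟩

theorem mul_mem_stage_succ {k : ℕ} {u : FreeMagma α} (hu : u ∈ stage b (k + 1)) :
    u * b k ∈ stage b (k + 1) := by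
  obtain ⟨a, ha, hne, m, rfl⟩ := hu
  exact ⟨a, ha, hne, m + 1, (Function.iterate_succ_apply' (fun c => c * b k) m a).symm⟩

/-- Step `j` deletes `b j`, and whatever is created from that step on is strictly heavier. -/
theorem IsBasicSequence.notMem_stage (hb : IsBasicSequence b) {j k : ℕ} (h : j < k) :
    b j ∉ stage b k := by
  induction k, h using Nat.le_induction with
  | base => exact fun hj => (mem_stage_succ_cases hj).elim (fun h => h.2 rfl) (lt_irrefl _)
  | succ k hk ih =>
    exact fun hj => (mem_stage_succ_cases hj).elim (fun h => ih h.1)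
      (fun h => h.not_ge (hb.monotone_length (Nat.le_of_succ_le hk)))

theorem IsBasicSequence.injective (hb : IsBasicSequence b) : Function.Injective b := by
  refine Function.Injective.of_lt_imp_ne fun j k hjk h => hb.notMem_stage hjk ?_
  rw [h]
  exact hb.mem_stage k

/-- From step `k` on, only expressions heavier than `b k` are created, so a later term no heavier
than `b k` was already present. -/
theorem IsBasicSequence.mem_stage_of_length_le (hb : IsBasicSequence b) {j k : ℕ} (hkj : k ≤ j)
    (h : (b j).length ≤ (b k).length) : b j ∈ stage b k := by
  induction hkj using Nat.decreasingInduction with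
  | self => exact hb.mem_stage j
  | of_succ k hk ih =>
    have h1 : (b k).length ≤ (b (k + 1)).length := hb.monotone_length k.le_succ
    exact (mem_stage_succ_cases (ih (h.trans h1))).elim (fun h => h.1) (fun h' => by omega)

theorem finite_length_le [Finite α] (n : ℕ) : {u : FreeMagma α | u.length ≤ n}.Finite := by
  induction n with
  | zero =>
    refine Set.finite_empty.subset fun u hu => ?_
    exact absurd (FreeMagma.length_pos u) (by simpa using hu)
  | succ n ih =>
    refine ((Set.finite_range FreeMagma.of).union (ih.image2 (· * ·) ih)).subset ?_
    rintro (a | ⟨u, v⟩) hu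
    · exact Or.inl ⟨a, rfl⟩
    · have hu : u.length + v.length ≤ n + 1 := hu
      have h1 := FreeMagma.length_pos u
      have h2 := FreeMagma.length_pos v
      exact Or.inr ⟨u, show u.length ≤ n by omega, v, show v.length ≤ n by omega, rfl⟩

theorem IsBasicSequence.exists_lt_iff_length_lt [Finite α] (hb : IsBasicSequence b) (n : ℕ) :
    ∃ N : ℕ, ∀ j, j < N ↔ (b j).length < n := by
  classical
  have hex : ∃ j, n ≤ (b j).length := by
    by_contra! h
    have hfin := (finite_length_le (α := α) n).subset
      (show Set.range b ⊆ {u | u.length ≤ n} by rintro _ ⟨j, rfl⟩; exact (h j).le)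
    exact Set.infinite_range_of_injective hb.injective hfin
  refine ⟨Nat.find hex, fun j => ?_⟩
  rw [Nat.lt_find_iff]
  refine ⟨fun h => not_le.1 (h j le_rfl), fun h m hm => not_le.2 ?_⟩
  exact lt_of_le_of_lt (hb.monotone_length hm) h

theorem star_nontrivial {A : Set (FreeMagma α)} (hA : A.Nontrivial) (c : FreeMagma α) :
    (star A c).Nontrivial := by
  obtain ⟨a, ha, hac⟩ := hA.exists_ne c
  refine ⟨a, ⟨a, ha, hac, 0, rfl⟩, a * c, ⟨a, ha, hac, 1, rfl⟩, fun h => ?_⟩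
  have h1 : a.length = a.length + c.length := congrArg FreeMagma.length h
  have h2 := FreeMagma.length_pos c
  omega

/-- Needed because the identification of the kernel with `γ_n(F)` does not mention a sequence. Two
symbols keep every stage from running empty. -/
theorem exists_isBasicSequence [Nontrivial α] : ∃ b : ℕ → FreeMagma α, IsBasicSequence b := by
  have hmin : ∀ A : {A : Set (FreeMagma α) // A.Nontrivial},
      ∃ c ∈ A.1, ∀ u ∈ A.1, c.length ≤ u.length := fun A =>
    ⟨Function.argminOn FreeMagma.length A.1 A.2.nonempty, Function.argminOn_mem _ _ _,
      fun u hu => Function.argminOn_le _ _ hu⟩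
  choose m hm hle using hmin
  have h0 : (Set.range (FreeMagma.of : α → FreeMagma α)).Nontrivial := by
    obtain ⟨x, y, hxy⟩ := exists_pair_ne α
    exact ⟨_, ⟨x, rfl⟩, _, ⟨y, rfl⟩, fun h => hxy (by injection h)⟩
  let S : ℕ → {A : Set (FreeMagma α) // A.Nontrivial} :=
    fun k => Nat.rec ⟨_, h0⟩ (fun _ A => ⟨star A.1 (m A), star_nontrivial A.2 _⟩) k
  have hS : ∀ k, stage (fun k => m (S k)) k = (S k).1 := by
    intro k
    induction k with
    | zero => rfl
    | succ k ih =>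
      change star (stage (fun k => m (S k)) k) (m (S k)) = star (S k).1 (m (S k))
      rw [ih]
  exact ⟨fun k => m (S k), fun k => (hS k).symm ▸ hm _, fun k => (hS k).symm ▸ hle _⟩

end Sequences

/-! ### The collecting process -/

section Collection

open scoped commutatorElement

variable {G : Type*} [Group G]

/-- Passing to `G ⧸ K` turns this into the three subgroups lemma. -/
theorem commutator_commutator_le_of_rotate {H₁ H₂ H₃ K : Subgroup G} [K.Normal]
    (h1 : ⁅⁅H₂, H₃⁆, H₁⁆ ≤ K) (h2 : ⁅⁅H₃, H₁⁆, H₂⁆ ≤ K) : ⁅⁅H₁, H₂⁆, H₃⁆ ≤ K := by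
  have key : ∀ L : Subgroup G, L ≤ K ↔ L.map (QuotientGroup.mk' K) = ⊥ := fun L => by
    rw [Subgroup.map_eq_bot_iff, QuotientGroup.ker_mk']
  rw [key, Subgroup.map_commutator, Subgroup.map_commutator] at *
  exact Subgroup.commutator_commutator_eq_bot_of_rotate h1 h2

theorem commutator_lowerCentralSeries_le (i j : ℕ) :
    ⁅(⊤ : Subgroup G).lowerCentralSeries i, (⊤ : Subgroup G).lowerCentralSeries j⁆ ≤
      (⊤ : Subgroup G).lowerCentralSeries (i + j + 1) := by
  induction j generalizing i with
  | zero => exact le_rfl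
  | succ j ih =>
    rw [Subgroup.commutator_comm, Subgroup.lowerCentralSeries_succ _ j]
    refine commutator_commutator_le_of_rotate ?_ ?_
    · rw [Subgroup.commutator_comm ⊤, ← Subgroup.lowerCentralSeries_succ]
      exact (ih (i + 1)).trans (Subgroup.lowerCentralSeries_antitone _ (by omega))
    · exact Subgroup.commutator_mono (ih i) le_rfl

theorem commutator_mem_gamma {i j : ℕ} (hi : 0 < i) (hj : 0 < j) {g h : G} (hg : g ∈ gamma G i)
    (hh : h ∈ gamma G j) : ⁅g, h⁆ ∈ gamma G (i + j) := by
  have := commutator_lowerCentralSeries_le _ _ (Subgroup.commutator_mem_commutator hg hh)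
  rwa [show i - 1 + (j - 1) + 1 = i + j - 1 by omega] at this

theorem gamma_antitone : Antitone (gamma G) := fun _ _ h =>
  Subgroup.lowerCentralSeries_antitone _ (Nat.sub_le_sub_right h 1)

variable {α : Type*} {b : ℕ → FreeMagma α}

theorem value_mul (y : α → G) (u v : FreeMagma α) :
    value y (u * v) = (value y u)⁻¹ * (value y v)⁻¹ * value y u * value y v := rfl

theorem map_value {G' : Type*} [Group G'] (f : G →* G') (y : α → G) (u : FreeMagma α) :
    f (value y u) = value (fun a => f (y a)) u := by
  induction u with
  | ih1 a => rfl
  | ih2 u v hu hv => simp only [value_mul, map_mul, map_inv, hu, hv]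

theorem value_mem_gamma (y : α → G) (u : FreeMagma α) : value y u ∈ gamma G u.length := by
  induction u with
  | ih1 a => exact Subgroup.mem_top _
  | ih2 u v hu hv =>
    rw [value_mul]
    -- `⁅g, h⁆` is `g h g⁻¹ h⁻¹`, so `value` takes the commutator of the inverses.
    simpa [commutatorElement_def] using
      commutator_mem_gamma u.length_pos v.length_pos (inv_mem hu) (inv_mem hv)

theorem powProd_zero (g : ℕ → G) (μ : Fin 0 → ℤ) : powProd g μ = 1 := by simp [powProd]

theorem powProd_succ (g : ℕ → G) {N : ℕ} (μ : Fin (N + 1) → ℤ) :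
    powProd g μ = powProd g (fun j => μ j.castSucc) * g N ^ μ (Fin.last N) := by
  rw [powProd, List.ofFn_succ', List.concat_eq_append, List.prod_append, List.prod_singleton]
  rfl

theorem map_powProd {G' : Type*} [Group G'] (f : G →* G') (g : ℕ → G) {N : ℕ} (μ : Fin N → ℤ) :
    f (powProd g μ) = powProd (fun j => f (g j)) μ := by
  induction N with
  | zero => simp [powProd_zero]
  | succ N ih => simp only [powProd_succ, map_mul, ih, map_zpow]

section

variable {y : α → G} {n : ℕ}

theorem conj_value_mem_closure (hv : ∀ u, n ≤ u.length → value y u = 1) {k : ℕ}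
    {u : FreeMagma α} (hu : u ∈ stage b (k + 1)) :
    value y (b k) * value y u * (value y (b k))⁻¹ ∈
      Subgroup.closure (value y '' stage b (k + 1)) := by
  -- With `c` the value of `b k`, `c u c⁻¹ = u (c [u, c] c⁻¹)⁻¹` and `[u, c]` is heavier than `u`.
  -- The induction is on the weight `d` still missing to reach `n`, where values become trivial.
  obtain ⟨d, hd⟩ : ∃ d, n ≤ u.length + d := ⟨n, Nat.le_add_left _ _⟩
  induction d generalizing u with
  | zero => simp [hv u hd, one_mem]
  | succ d ih =>
    have h1 := ih (mul_mem_stage_succ hu) (by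
      change n ≤ u.length + (b k).length + d
      have := (b k).length_pos
      omega)
    have h2 : value y u ∈ Subgroup.closure (value y '' stage b (k + 1)) :=
      Subgroup.subset_closure ⟨u, hu, rfl⟩
    convert mul_mem h2 (inv_mem h1) using 1
    rw [value_mul]
    group

theorem value_mem_normalizer (hv : ∀ u, n ≤ u.length → value y u = 1) (k : ℕ) :
    value y (b k) ∈ Subgroup.normalizer
      (Subgroup.closure (value y '' stage b (k + 1)) : Set G) := by
  set c := value y (b k)
  set K := Subgroup.closure (value y '' stage b (k + 1))
  have h1 : K ≤ K.comap (MulAut.conj c).toMonoidHom := by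
    rw [Subgroup.closure_le]
    rintro _ ⟨u, hu, rfl⟩
    simpa using conj_value_mem_closure hv hu
  -- This direction needs no induction: `c⁻¹ u c = u [u, c]`.
  have h2 : K ≤ K.comap (MulAut.conj c⁻¹).toMonoidHom := by
    rw [Subgroup.closure_le]
    rintro _ ⟨u, hu, rfl⟩
    have := mul_mem (Subgroup.subset_closure ⟨u, hu, rfl⟩ : value y u ∈ K)
      (Subgroup.subset_closure ⟨_, mul_mem_stage_succ hu, rfl⟩ : value y (u * b k) ∈ K)
    simpa [value_mul, mul_assoc] using this
  rw [Subgroup.mem_normalizer_iff]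
  refine fun h => ⟨fun hh => by simpa using h1 hh, fun hh => ?_⟩
  simpa [mul_assoc] using h2 hh

theorem exists_zpow_mul_of_mem_closure_stage (hv : ∀ u, n ≤ u.length → value y u = 1) {k : ℕ}
    {g : G} (hg : g ∈ Subgroup.closure (value y '' stage b k)) :
    ∃ m : ℤ, ∃ h ∈ Subgroup.closure (value y '' stage b (k + 1)),
      g = value y (b k) ^ m * h := by
  have hle : Subgroup.closure (value y '' stage b k) ≤
      Subgroup.zpowers (value y (b k)) ⊔ Subgroup.closure (value y '' stage b (k + 1)) := by
    rw [Subgroup.closure_le]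
    rintro _ ⟨u, hu, rfl⟩
    by_cases h : u = b k
    · exact Subgroup.mem_sup_left (h ▸ Subgroup.mem_zpowers _)
    · exact Subgroup.mem_sup_right (Subgroup.subset_closure ⟨u, mem_stage_succ_of_ne hu h, rfl⟩)
  have := hle hg
  rw [← SetLike.mem_coe, Subgroup.coe_mul_of_left_le_normalizer_right] at this
  · obtain ⟨_, ⟨m, rfl⟩, h, hh, rfl⟩ := this
    exact ⟨m, h, hh, rfl⟩
  · rw [Subgroup.zpowers_le]
    exact value_mem_normalizer hv k

theorem exists_powProd_mul_of_mem_closure_range (hv : ∀ u, n ≤ u.length → value y u = 1) {g : G}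
    (hg : g ∈ Subgroup.closure (Set.range y)) (b : ℕ → FreeMagma α) (k : ℕ) :
    ∃ μ : Fin k → ℤ, ∃ h ∈ Subgroup.closure (value y '' stage b k),
      g = powProd (fun j => value y (b j)) μ * h := by
  induction k with
  | zero =>
    refine ⟨Fin.elim0, g, ?_, by simp [powProd_zero]⟩
    rwa [stage, ← Set.range_comp]
  | succ k ih =>
    obtain ⟨μ, h, hh, rfl⟩ := ih
    obtain ⟨m, h', hh', rfl⟩ := exists_zpow_mul_of_mem_closure_stage hv hh
    exact ⟨Fin.snoc (α := fun _ => ℤ) μ m, h', hh', by simp [powProd_succ, mul_assoc]⟩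

theorem IsBasicSequence.exists_eq_powProd (hb : IsBasicSequence b)
    (hv : ∀ u, n ≤ u.length → value y u = 1) {g : G} (hg : g ∈ Subgroup.closure (Set.range y))
    {N : ℕ} (hN : n ≤ (b N).length) :
    ∃ μ : Fin N → ℤ, g = powProd (fun j => value y (b j)) μ := by
  obtain ⟨μ, h, hh, rfl⟩ := exists_powProd_mul_of_mem_closure_range hv hg b N
  have h1 : Subgroup.closure (value y '' stage b N) ≤ ⊥ := by
    rw [Subgroup.closure_le]
    rintro _ ⟨u, hu, rfl⟩
    exact hv u (hN.trans (hb.length_le N u hu))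
  exact ⟨μ, by rw [Subgroup.mem_bot.1 (h1 hh), mul_one]⟩

end

end Collection

/-! ### Lie elements in associative rings -/

section LieValue

variable {α A B : Type*} [Ring A] [Ring B]

/-- The value in an associative ring of a formal expression, for given values of the symbols, where
`[u, v]` is interpreted as `u v - v u`. -/
def lieValue (x : α → A) : FreeMagma α → A
  | .of a => x a
  | .mul u v => lieValue x u * lieValue x v - lieValue x v * lieValue x u

theorem lieValue_of (x : α → A) (a : α) : lieValue x (FreeMagma.of a) = x a := rfl

theorem lieValue_mul (x : α → A) (u v : FreeMagma α) :
    lieValue x (u * v) = lieValue x u * lieValue x v - lieValue x v * lieValue x u := rfl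

theorem map_lieValue (f : A →+* B) (x : α → A) (u : FreeMagma α) :
    f (lieValue x u) = lieValue (fun a => f (x a)) u := by
  induction u with
  | ih1 a => rfl
  | ih2 u v hu hv => simp only [lieValue_mul, map_mul, map_sub, hu, hv]

theorem lieValue_iterate_mul (x : α → A) (a b : FreeMagma α) (m : ℕ) :
    lieValue x ((fun u => u * b)^[m] a) =
      (fun c => c * lieValue x b - lieValue x b * c)^[m] (lieValue x a) := by
  induction m with
  | zero => rfl
  | succ m ih => rw [Function.iterate_succ_apply', Function.iterate_succ_apply', lieValue_mul, ih]

theorem map_iterate_bracket (f : A →+* B) (a b : A) (m : ℕ) :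
    f ((fun c => c * b - b * c)^[m] a) = (fun c => c * f b - f b * c)^[m] (f a) := by
  induction m with
  | zero => rfl
  | succ m ih => simp only [Function.iterate_succ_apply', map_sub, map_mul, ih]

end LieValue

/-! ### Lazard elimination and linear independence of basic Lie elements -/

section Elimination

variable (R : Type*) [CommRing R]

theorem exists_freeAlgebra_derivation {Y : Type*} (D : Y → Y) :
    ∃ δ : FreeAlgebra R Y →ₗ[R] FreeAlgebra R Y, ∀ (y : Y) (p : FreeAlgebra R Y),
      δ (FreeAlgebra.ι R y * p) =
        FreeAlgebra.ι R (D y) * p + FreeAlgebra.ι R y * δ p := by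
  -- The derivation extending `D` is the `ε`-part of the homomorphism `y ↦ y + ε D y` into the dual
  -- numbers.
  let f : FreeAlgebra R Y →ₐ[R] TrivSqZeroExt (FreeAlgebra R Y) (FreeAlgebra R Y) :=
    FreeAlgebra.lift R fun y =>
      TrivSqZeroExt.inl (FreeAlgebra.ι R y) + TrivSqZeroExt.inr (FreeAlgebra.ι R (D y))
  have hf : (TrivSqZeroExt.fstHom R (FreeAlgebra R Y) (FreeAlgebra R Y)).comp f =
      AlgHom.id R _ := by
    ext y
    simp [f]
  have hf' : ∀ p, (f p).fst = p := fun p => DFunLike.congr_fun hf p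
  refine ⟨(TrivSqZeroExt.sndHom (FreeAlgebra R Y) (FreeAlgebra R Y)).restrictScalars R ∘ₗ
    f.toLinearMap, fun y p => ?_⟩
  have h1 : f (FreeAlgebra.ι R y) =
      TrivSqZeroExt.inl (FreeAlgebra.ι R y) + TrivSqZeroExt.inr (FreeAlgebra.ι R (D y)) := by
    simp [f]
  simp [h1, hf', add_comm]

/-- Lazard elimination: if `b` is one of the free generators of a free ring, then the elements
`[…[[a, b], b]…, b]` with free generators `a ≠ b` are free generators of a subring. -/
theorem lift_injective_of_iterate_bracket {X Y : Type*} (b : X) (D : Y → Y)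
    (s : {a : X // a ≠ b} → Y) (f : Y → FreeAlgebra R X)
    (hf : ∀ y, ∃ a, ∃ m : ℕ, y = D^[m] (s a) ∧
      f y = (fun c => c * FreeAlgebra.ι R b - FreeAlgebra.ι R b * c)^[m] (FreeAlgebra.ι R a.1)) :
    Function.Injective (FreeAlgebra.lift R f) := by
  classical
  obtain ⟨δ, hδ⟩ := exists_freeAlgebra_derivation R D
  -- Since `L_y (-δ) - (-δ) L_y = L_{D y}` for left multiplications, bracketing with `b` on the
  -- right acts on generators as `D`. So `ρ` sends each `f y` to left multiplication by `y`, and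
  -- evaluation at 1 inverts `lift f`.
  let ρ : FreeAlgebra R X →ₐ[R] Module.End R (FreeAlgebra R Y) := FreeAlgebra.lift R fun a =>
    if h : a = b then -δ else LinearMap.mulLeft R (FreeAlgebra.ι R (s ⟨a, h⟩))
  have hb : ρ (FreeAlgebra.ι R b) = -δ := by simp [ρ]
  have ha : ∀ a : {a : X // a ≠ b},
      ρ (FreeAlgebra.ι R a.1) = LinearMap.mulLeft R (FreeAlgebra.ι R (s a)) := fun a => by
    simp [ρ, a.2]
  have hiter : ∀ (m : ℕ) (y : Y),
      (fun c => c * (-δ) - (-δ) * c)^[m] (LinearMap.mulLeft R (FreeAlgebra.ι R y)) =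
        LinearMap.mulLeft R (FreeAlgebra.ι R (D^[m] y)) := by
    intro m y
    induction m with
    | zero => rfl
    | succ m ih =>
      rw [Function.iterate_succ_apply', ih, Function.iterate_succ_apply']
      ext1 p
      simp [hδ]
  have hρ : ρ.comp (FreeAlgebra.lift R f) = Algebra.lmul R (FreeAlgebra R Y) := by
    ext1
    funext y
    obtain ⟨a, m, rfl, h⟩ := hf y
    have h2 := map_iterate_bracket ρ.toRingHom (FreeAlgebra.ι R a.1) (FreeAlgebra.ι R b) m
    simp only [AlgHom.toRingHom_eq_coe, RingHom.coe_coe, hb, ha, hiter] at h2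
    simp only [Function.comp_apply, AlgHom.comp_apply, FreeAlgebra.lift_ι_apply, h, h2]
    rfl
  intro p p' h
  have h2 : ∀ p, ρ (FreeAlgebra.lift R f p) 1 = p := fun p => by
    rw [← AlgHom.comp_apply, hρ]
    simp
  rw [← h2 p, h, h2]

variable {α : Type*} {b : ℕ → FreeMagma α}

theorem lift_lieValue_stage_injective (hb : ∀ k, b k ∈ stage b k) (k : ℕ) :
    Function.Injective (FreeAlgebra.lift R
      fun u : stage b k => lieValue (FreeAlgebra.ι R (X := α)) u.1) := by
  induction k with
  | zero =>
    let g : FreeAlgebra R α →ₐ[R] FreeAlgebra R (stage b 0) :=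
      FreeAlgebra.lift R fun a => FreeAlgebra.ι R ⟨FreeMagma.of a, a, rfl⟩
    have hg : g.comp (FreeAlgebra.lift R
        fun u : stage b 0 => lieValue (FreeAlgebra.ι R (X := α)) u.1) = AlgHom.id R _ := by
      ext1
      funext u
      obtain ⟨_, a, rfl⟩ := u
      simp [g, lieValue_of]
    exact Function.LeftInverse.injective (g := g) fun p => DFunLike.congr_fun hg p
  | succ k ih =>
    have hdec : ∀ u : stage b (k + 1), ∃ a : {a : stage b k // a ≠ ⟨b k, hb k⟩}, ∃ m : ℕ,
        u.1 = (fun c => c * b k)^[m] a.1.1 := by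
      rintro ⟨_, a, ha, hne, m, rfl⟩
      exact ⟨⟨⟨a, ha⟩, fun h => hne (congrArg Subtype.val h)⟩, m, rfl⟩
    -- Any decomposition will do; its uniqueness is not needed.
    choose a m hm using hdec
    let bk : stage b k := ⟨b k, hb k⟩
    let f : stage b (k + 1) → FreeAlgebra R (stage b k) := fun u =>
      (fun c => c * FreeAlgebra.ι R bk - FreeAlgebra.ι R bk * c)^[m u] (FreeAlgebra.ι R (a u).1)
    have hfi : Function.Injective (FreeAlgebra.lift R f) := by
      refine lift_injective_of_iterate_bracket R bk
        (fun u => ⟨u.1 * b k, mul_mem_stage_succ u.2⟩)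
        (fun a => ⟨a.1.1, mem_stage_succ_of_ne a.1.2 fun h => a.2 (Subtype.ext h)⟩) f
        fun u => ⟨a u, m u, Subtype.ext ?_, rfl⟩
      rw [hm u]
      exact (Function.Semiconj.iterate_right (f := Subtype.val)
        (ga := fun u : stage b (k + 1) => ⟨u.1 * b k, mul_mem_stage_succ u.2⟩)
        (gb := fun c => c * b k) (fun _ => rfl) (m u)
        ⟨(a u).1.1, _⟩).symm
    have hcomp : FreeAlgebra.lift R
        (fun u : stage b (k + 1) => lieValue (FreeAlgebra.ι R (X := α)) u.1) =
        (FreeAlgebra.lift R fun u : stage b k => lieValue (FreeAlgebra.ι R (X := α)) u.1).comp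
          (FreeAlgebra.lift R f) := by
      ext1
      funext u
      have h2 := map_iterate_bracket (FreeAlgebra.lift R
        fun u : stage b k => lieValue (FreeAlgebra.ι R (X := α)) u.1).toRingHom
        (FreeAlgebra.ι R (a u).1) (FreeAlgebra.ι R bk) (m u)
      simp only [AlgHom.toRingHom_eq_coe, RingHom.coe_coe, FreeAlgebra.lift_ι_apply] at h2
      simp only [Function.comp_apply, AlgHom.comp_apply, FreeAlgebra.lift_ι_apply, f, h2]
      rw [hm u, lieValue_iterate_mul]
    rw [hcomp, AlgHom.coe_comp]
    exact ih.comp hfi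

theorem linearIndependent_ι (X : Type*) :
    LinearIndependent R (FreeAlgebra.ι R : X → FreeAlgebra R X) := by
  have h := (FreeAlgebra.basisFreeMonoid R X).linearIndependent.comp FreeMonoid.of
    FreeMonoid.of_injective
  convert h using 1
  funext x
  simp [FreeAlgebra.basisFreeMonoid, FreeAlgebra.equivMonoidAlgebraFreeMonoid]

/-- At the first index where weight `w` occurs, the stage contains all terms of weight `w`; free
generators are linearly independent. -/
theorem IsBasicSequence.linearIndependent_lieValue (hb : IsBasicSequence b) (w : ℕ) :
    LinearIndependent R fun j : {j : ℕ // (b j).length = w} =>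
      lieValue (FreeAlgebra.ι R (X := α)) (b j) := by
  classical
  by_cases hw : ∃ j, (b j).length = w
  · have hle : ∀ j : {j : ℕ // (b j).length = w}, b j ∈ stage b (Nat.find hw) := fun j =>
      hb.mem_stage_of_length_le (Nat.find_min' hw j.2) (j.2.trans (Nat.find_spec hw).symm).le
    have h1 := (linearIndependent_ι R (stage b (Nat.find hw))).map_injOn (FreeAlgebra.lift R
      fun u : stage b (Nat.find hw) => lieValue (FreeAlgebra.ι R (X := α)) u.1).toLinearMap
      (lift_lieValue_stage_injective R hb.mem_stage _).injOn
    have h2 := h1.comp (fun j : {j : ℕ // (b j).length = w} => ⟨b j, hle j⟩)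
      (fun i j h => Subtype.ext (hb.injective (congrArg Subtype.val h)))
    have heq : (fun j : {j : ℕ // (b j).length = w} => lieValue (FreeAlgebra.ι R (X := α)) (b j)) =
        ((FreeAlgebra.lift R fun u : stage b (Nat.find hw) =>
          lieValue (FreeAlgebra.ι R (X := α)) u.1).toLinearMap ∘ FreeAlgebra.ι R) ∘
            fun j : {j : ℕ // (b j).length = w} => ⟨b j, hle j⟩ := by
      funext j
      simp
    rw [heq]
    exact h2
  · have : IsEmpty {j : ℕ // (b j).length = w} := ⟨fun j => hw ⟨j, j.2⟩⟩
    exact linearIndependent_empty_type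

end Elimination

/-! ### The grading and passage to the truncated ring -/

section Truncation

open Polynomial

/-- The ring homomorphism of the free associative ring into its polynomial ring that multiplies
each free generator by the indeterminate, and so exhibits the grading. -/
noncomputable def gradingHom (q : ℕ) : FreeAlgebra ℤ (Fin q) →+* (FreeAlgebra ℤ (Fin q))[X] :=
  (FreeAlgebra.lift ℤ fun i => C (FreeAlgebra.ι ℤ i) * X :
    FreeAlgebra ℤ (Fin q) →ₐ[ℤ] (FreeAlgebra ℤ (Fin q))[X]).toRingHom

theorem gradingHom_ι (q : ℕ) (i : Fin q) :
    gradingHom q (FreeAlgebra.ι ℤ i) = C (FreeAlgebra.ι ℤ i) * X :=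
  FreeAlgebra.lift_ι_apply _ _

theorem gradingHom_lieValue (q : ℕ) (u : FreeMagma (Fin q)) :
    gradingHom q (lieValue (FreeAlgebra.ι ℤ) u) =
      C (lieValue (FreeAlgebra.ι ℤ) u) * X ^ u.length := by
  induction u with
  | ih1 a => simp [lieValue_of, gradingHom_ι]
  | ih2 u v hu hv =>
    have key : ∀ (c d : FreeAlgebra ℤ (Fin q)) (i j : ℕ),
        C c * X ^ i * (C d * X ^ j) = C (c * d) * X ^ (i + j) := fun c d i j => by
      rw [mul_assoc, ← mul_assoc (X ^ i), X_pow_mul_C, mul_assoc, ← pow_add, ← mul_assoc, C_mul]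
    have hl : (u * v).length = u.length + v.length := rfl
    rw [lieValue_mul, map_sub, map_mul, map_mul, hu, hv, key, key, hl, add_comm v.length, C_sub,
      sub_mul]

theorem coeff_zero_gradingHom (q : ℕ) (r : FreeAlgebra ℤ (Fin q)) :
    (gradingHom q r).coeff 0 = algebraMap ℤ _ (FreeAlgebra.algebraMapInv r) := by
  induction r using FreeAlgebra.induction with
  | grade0 n => simp [gradingHom]
  | grade1 i => simp [gradingHom_ι, FreeAlgebra.algebraMapInv]
  | mul r s hr hs => rw [map_mul, mul_coeff_zero, hr, hs, map_mul, map_mul]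
  | add r s hr hs => rw [map_add, coeff_add, hr, hs, map_add, map_add]

theorem X_pow_dvd_gradingHom {q n : ℕ} {r : FreeAlgebra ℤ (Fin q)} (hr : r ∈ augIdeal q ^ n) :
    X ^ n ∣ gradingHom q r := by
  induction n generalizing r with
  | zero => simp
  | succ n ih =>
    rw [Submodule.pow_succ] at hr
    refine Submodule.mul_induction_on hr (fun s hs t ht => ?_) fun s t hs ht => ?_
    · obtain ⟨c, hc⟩ := ih hs
      obtain ⟨d, hd⟩ : X ∣ gradingHom q t := by
        rw [X_dvd_iff, coeff_zero_gradingHom]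
        rw [augIdeal, RingHom.mem_ker] at ht
        rw [show FreeAlgebra.algebraMapInv t = 0 from ht, map_zero]
      refine ⟨c * d, ?_⟩
      rw [map_mul, hc, hd, mul_assoc, ← mul_assoc c, ← X_mul, pow_succ]
      simp only [mul_assoc]
    · rw [map_add]
      exact dvd_add hs ht

/-- A relation modulo `𝔨 ^ (w + 1)` lifts to a combination homogeneous of degree `w`. The
coefficient of `X ^ w` in its graded image is the combination itself, and it vanishes. -/
theorem IsBasicSequence.linearIndependent_lieValue_truncVar {q : ℕ} {b : ℕ → FreeMagma (Fin q)}
    (hb : IsBasicSequence b) (w : ℕ) :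
    LinearIndependent ℤ fun j : {j : ℕ // (b j).length = w} =>
      lieValue (truncVar q (w + 1)) (b j) := by
  rw [linearIndependent_iff']
  intro s g hg
  have h1 : ∑ j ∈ s, g j • lieValue (FreeAlgebra.ι ℤ) (b j) ∈ augIdeal q ^ (w + 1) := by
    rw [← Ideal.Quotient.eq_zero_iff_mem, map_sum, ← hg]
    refine Finset.sum_congr rfl fun j _ => ?_
    rw [map_zsmul, map_lieValue]
    rfl
  have h2 := X_pow_dvd_iff.1 (X_pow_dvd_gradingHom h1) w w.lt_succ_self
  have h3 : ∑ j ∈ s, g j • lieValue (FreeAlgebra.ι ℤ) (b j) = 0 := by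
    rw [← h2, map_sum, finsetSum_coeff]
    refine Finset.sum_congr rfl fun j _ => ?_
    rw [map_zsmul, gradingHom_lieValue, j.2, coeff_smul]
    simp
  refine linearIndependent_iff'.1 (hb.linearIndependent_lieValue ℤ w) s g ?_
  rw [← h3]
  refine Finset.sum_congr rfl fun j _ => ?_
  exact int_smul_eq_zsmul _ _ _

end Truncation

/-! ### Filtered rings and leading terms of commutators -/

section Filtration

open scoped commutatorElement

variable {A : Type*} [Ring A]

/-- A multiplicative decreasing filtration of a ring by additive subgroups. -/
structure IsMulFiltration (J : ℕ → AddSubgroup A) : Prop where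
  zero : J 0 = ⊤
  antitone : Antitone J
  mul_mem : ∀ {i j : ℕ} {a b : A}, a ∈ J i → b ∈ J j → a * b ∈ J (i + j)

variable {J : ℕ → AddSubgroup A}

theorem IsMulFiltration.mul_mem_left (hJ : IsMulFiltration J) {i : ℕ} (a : A) {b : A}
    (hb : b ∈ J i) : a * b ∈ J i := by
  have h := hJ.mul_mem (i := 0) (a := a) (by simp [hJ.zero]) hb
  rwa [zero_add] at h

/-- The subgroup of the units congruent to one modulo the `i`-th term of a filtration. -/
def IsMulFiltration.unitsSubgroup (hJ : IsMulFiltration J) (i : ℕ) : Subgroup Aˣ where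
  carrier := {u | (u : A) - 1 ∈ J i}
  one_mem' := by simp
  mul_mem' {u v} hu hv := by
    have h : ((u * v : Aˣ) : A) - 1 = u * ((v : A) - 1) + ((u : A) - 1) := by
      push_cast
      noncomm_ring
    rw [Set.mem_ofPred_eq, h]
    exact add_mem (hJ.mul_mem_left _ hv) hu
  inv_mem' {u} hu := by
    have h : ((u⁻¹ : Aˣ) : A) - 1 = -(((u⁻¹ : Aˣ) : A) * ((u : A) - 1)) := by
      rw [mul_sub, Units.inv_mul]
      simp
    rw [Set.mem_ofPred_eq, h]
    exact neg_mem (hJ.mul_mem_left _ hu)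

theorem IsMulFiltration.mem_unitsSubgroup {hJ : IsMulFiltration J} {i : ℕ} {u : Aˣ} :
    u ∈ hJ.unitsSubgroup i ↔ (u : A) - 1 ∈ J i := Iff.rfl

/-- `uv - vu` does not change when 1 is subtracted from `u` and `v`; this is why commutators add
filtration degrees. -/
theorem inv_mul_inv_mul_mul_sub_one (u v : Aˣ) :
    ((u⁻¹ * v⁻¹ * u * v : Aˣ) : A) - 1 = ((u⁻¹ * v⁻¹ : Aˣ) : A) *
      (((u : A) - 1) * ((v : A) - 1) - ((v : A) - 1) * ((u : A) - 1)) := by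
  have h : ((u : A) - 1) * ((v : A) - 1) - ((v : A) - 1) * ((u : A) - 1) = u * v - v * u := by
    noncomm_ring
  have h1 : ((u⁻¹ * v⁻¹ : Aˣ) : A) * ((v : A) * u) = 1 := by
    rw [← Units.val_mul, ← Units.val_mul]
    simp
  rw [h, mul_sub, h1]
  simp [mul_assoc]

theorem IsMulFiltration.commutator_mem_unitsSubgroup (hJ : IsMulFiltration J) {i j : ℕ} {u v : Aˣ}
    (hu : u ∈ hJ.unitsSubgroup i) (hv : v ∈ hJ.unitsSubgroup j) :
    ⁅u, v⁆ ∈ hJ.unitsSubgroup (i + j) := by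
  have h := inv_mul_inv_mul_mul_sub_one u⁻¹ v⁻¹
  rw [inv_inv, inv_inv, ← commutatorElement_def] at h
  rw [mem_unitsSubgroup, h]
  have hu' := mem_unitsSubgroup.1 (inv_mem hu)
  have hv' := mem_unitsSubgroup.1 (inv_mem hv)
  refine hJ.mul_mem_left _ (sub_mem (hJ.mul_mem hu' hv') ?_)
  rw [add_comm i]
  exact hJ.mul_mem hv' hu'

theorem IsMulFiltration.gamma_le_comap (hJ : IsMulFiltration J) {G : Type*} [Group G]
    (φ : G →* Aˣ) (hφ : ∀ g, φ g ∈ hJ.unitsSubgroup 1) {n : ℕ} (hn : 0 < n) :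
    gamma G n ≤ (hJ.unitsSubgroup n).comap φ := by
  obtain ⟨n, rfl⟩ := Nat.exists_eq_add_of_le' hn
  change (⊤ : Subgroup G).lowerCentralSeries n ≤ _
  induction n with
  | zero => exact fun g _ => hφ g
  | succ n ih =>
    rw [Subgroup.lowerCentralSeries_succ, Subgroup.commutator_le]
    intro g hg h _
    rw [Subgroup.mem_comap, map_commutatorElement]
    exact hJ.commutator_mem_unitsSubgroup (ih n.succ_pos hg) (hφ h)

variable {α : Type*} {x : α → A} {y : α → Aˣ}

theorem IsMulFiltration.lieValue_mem (hJ : IsMulFiltration J) (hx : ∀ a, x a ∈ J 1)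
    (u : FreeMagma α) : lieValue x u ∈ J u.length := by
  induction u with
  | ih1 a => exact hx a
  | ih2 u v hu hv =>
    refine sub_mem (hJ.mul_mem hu hv) ?_
    have := hJ.mul_mem hv hu
    rwa [add_comm] at this

theorem IsMulFiltration.value_sub_one_sub_lieValue_mem (hJ : IsMulFiltration J)
    (hx : ∀ a, x a ∈ J 1) (hy : ∀ a, (y a : A) = 1 + x a) (u : FreeMagma α) :
    ((value y u : Aˣ) : A) - 1 - lieValue x u ∈ J (u.length + 1) := by
  have hone : ∀ u : FreeMagma α, ((value y u : Aˣ) : A) - 1 - lieValue x u ∈ J (u.length + 1) →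
      value y u ∈ hJ.unitsSubgroup u.length := fun u hu => by
    have := add_mem (hJ.antitone (Nat.le_succ _) hu) (hJ.lieValue_mem hx u)
    rwa [sub_add_cancel] at this
  -- From `ac - a'c' = (a - a')c + a'(c - c')`.
  have hprod : ∀ {i j : ℕ} {a a' c c' : A}, a - a' ∈ J (i + 1) → a' ∈ J i → c ∈ J j →
      c - c' ∈ J (j + 1) → a * c - a' * c' ∈ J (i + j + 1) := by
    intro i j a a' c c' ha ha' hc hc'
    have h1 := hJ.mul_mem ha hc
    have h2 := hJ.mul_mem ha' hc'
    rw [add_right_comm] at h1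
    rw [← add_assoc] at h2
    convert add_mem h1 h2 using 1
    noncomm_ring
  induction u with
  | ih1 a => simp [value, lieValue_of, hy]
  | ih2 u v hu hv =>
    set a := ((value y u : Aˣ) : A) - 1
    set c := ((value y v : Aˣ) : A) - 1
    have ha : a ∈ J u.length := hone u hu
    have hc : c ∈ J v.length := hone v hv
    have h1 := hprod hu (hJ.lieValue_mem hx u) hc hv
    have h2 := hprod hv (hJ.lieValue_mem hx v) ha hu
    rw [add_comm v.length] at h2
    -- The unit factor in `inv_mul_inv_mul_mul_sub_one` is 1 modulo `J 1`, so it does not affect the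
    -- leading term.
    have h3 : (((value y u)⁻¹ * (value y v)⁻¹ : Aˣ) : A) - 1 ∈ J 1 :=
      (hJ.unitsSubgroup 1).mul_mem
        ((hJ.unitsSubgroup 1).inv_mem (hJ.antitone u.length_pos ha))
        ((hJ.unitsSubgroup 1).inv_mem (hJ.antitone v.length_pos hc))
    have h4 : a * c - c * a ∈ J (u.length + v.length) := by
      refine sub_mem (hJ.mul_mem ha hc) ?_
      rw [add_comm]
      exact hJ.mul_mem hc ha
    have h5 := hJ.mul_mem h3 h4
    rw [add_comm 1] at h5
    rw [value_mul, inv_mul_inv_mul_mul_sub_one, lieValue_mul]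
    change _ ∈ J (u.length + v.length + 1)
    convert add_mem h5 (sub_mem h1 h2) using 1
    simp only [a, c]
    noncomm_ring

end Filtration

/-! ### The Magnus homomorphism into the truncated ring -/

section TruncFiltration

variable {q n : ℕ}

/-- The image of the `i`-th power of the augmentation ideal in the truncated ring. -/
def truncFiltration (q n i : ℕ) : AddSubgroup (TruncRing q n) :=
  (augIdeal q ^ i).toAddSubgroup.map (Ideal.Quotient.mk (augIdeal q ^ n)).toAddMonoidHom

theorem isMulFiltration_truncFiltration (q n : ℕ) : IsMulFiltration (truncFiltration q n) where
  zero := by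
    rw [eq_top_iff]
    intro x _
    obtain ⟨r, rfl⟩ := Ideal.Quotient.mk_surjective x
    refine ⟨r, ?_, rfl⟩
    rw [Submodule.pow_zero, Ideal.one_eq_top]
    trivial
  antitone i j h := AddSubgroup.map_mono (Ideal.pow_le_pow_right h)
  mul_mem := by
    rintro i j _ _ ⟨r, hr, rfl⟩ ⟨s, hs, rfl⟩
    refine ⟨r * s, ?_, map_mul (Ideal.Quotient.mk (augIdeal q ^ n)) r s⟩
    have h := Ideal.mul_mem_mul hr hs
    rwa [← Ideal.IsTwoSided.pow_add] at h

theorem eq_zero_of_mem_truncFiltration {i : ℕ} (h : n ≤ i) {x : TruncRing q n}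
    (hx : x ∈ truncFiltration q n i) : x = 0 := by
  obtain ⟨r, hr, rfl⟩ := hx
  exact Ideal.Quotient.eq_zero_iff_mem.2 (Ideal.pow_le_pow_right h hr)

theorem truncVar_mem (i : Fin q) : truncVar q n i ∈ truncFiltration q n 1 := by
  refine ⟨FreeAlgebra.ι ℤ i, ?_, rfl⟩
  rw [Submodule.pow_one]
  change FreeAlgebra.algebraMapInv (FreeAlgebra.ι ℤ i) = 0
  simp [FreeAlgebra.algebraMapInv]

theorem val_truncUnit (i : Fin q) : (truncUnit q n i : TruncRing q n) = 1 + truncVar q n i := rfl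

/-- The homomorphism of the free group into the units of the truncated free associative ring. -/
noncomputable def magnusHom (q n : ℕ) : FreeGroup (Fin q) →* (TruncRing q n)ˣ :=
  FreeGroup.lift (truncUnit q n)

theorem magnusHom_of (i : Fin q) : magnusHom q n (FreeGroup.of i) = truncUnit q n i :=
  FreeGroup.lift_apply_of

theorem magnusHom_value (u : FreeMagma (Fin q)) :
    magnusHom q n (value FreeGroup.of u) = value (truncUnit q n) u := by
  rw [map_value]
  simp only [magnusHom_of]

theorem magnusHom_mem_unitsSubgroup (g : FreeGroup (Fin q)) :
    magnusHom q n g ∈ (isMulFiltration_truncFiltration q n).unitsSubgroup 1 := by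
  have h : (magnusHom q n).range ≤ (isMulFiltration_truncFiltration q n).unitsSubgroup 1 := by
    rw [magnusHom, FreeGroup.range_lift_eq_closure, Subgroup.closure_le]
    rintro _ ⟨i, rfl⟩
    change (truncUnit q n i : TruncRing q n) - 1 ∈ truncFiltration q n 1
    rw [val_truncUnit, add_sub_cancel_left]
    exact truncVar_mem i
  exact h ⟨g, rfl⟩

theorem gamma_le_ker_magnusHom (hn : 0 < n) :
    gamma (FreeGroup (Fin q)) n ≤ (magnusHom q n).ker := fun g hg => by
  have h := (isMulFiltration_truncFiltration q n).gamma_le_comap (magnusHom q n)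
    magnusHom_mem_unitsSubgroup hn hg
  exact Units.ext (sub_eq_zero.1 (eq_zero_of_mem_truncFiltration le_rfl h))

theorem ker_magnusHom_antitone (q : ℕ) : Antitone fun n => (magnusHom q n).ker := by
  intro m n hmn
  have h : (Units.map (Ideal.Quotient.factor (Ideal.pow_le_pow_right hmn) :
      TruncRing q n →+* TruncRing q m).toMonoidHom).comp (magnusHom q n) = magnusHom q m := by
    ext i
    simp only [MonoidHom.comp_apply, magnusHom_of]
    simp [val_truncUnit, truncVar]
  intro g hg
  rw [MonoidHom.mem_ker] at hg ⊢
  rw [← h, MonoidHom.comp_apply, hg, map_one]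

/-- Top-degree elements are annihilated by `𝔨`, and the units in question are 1 modulo `𝔨`. -/
theorem magnusHom_mul_eq_of_mem {w : ℕ} {x : TruncRing q (w + 1)}
    (hx : x ∈ truncFiltration q (w + 1) w) (g : FreeGroup (Fin q)) :
    x * (magnusHom q (w + 1) g : TruncRing q (w + 1)) = x ∧
      (magnusHom q (w + 1) g : TruncRing q (w + 1)) * x = x := by
  have hJ := isMulFiltration_truncFiltration q (w + 1)
  have hg : (magnusHom q (w + 1) g : TruncRing q (w + 1)) - 1 ∈ truncFiltration q (w + 1) 1 :=
    magnusHom_mem_unitsSubgroup g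
  have h1 := eq_zero_of_mem_truncFiltration le_rfl (hJ.mul_mem hx hg)
  have h2 := eq_zero_of_mem_truncFiltration (Nat.add_comm w 1).le (hJ.mul_mem hg hx)
  rw [mul_sub, mul_one, sub_eq_zero] at h1
  rw [sub_mul, one_mul, sub_eq_zero] at h2
  exact ⟨h1, h2⟩

theorem val_zpow_of_mul_self_eq_zero {A : Type*} [Ring A] {u : Aˣ} {x : A} (hu : (u : A) = 1 + x)
    (hx : x * x = 0) (m : ℤ) : ((u ^ m : Aˣ) : A) = 1 + m • x := by
  have hinv : ((u⁻¹ : Aˣ) : A) = 1 - x := by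
    rw [Units.inv_eq_of_mul_eq_one_right]
    rw [hu, mul_sub, add_mul, add_mul, hx]
    simp
  induction m with
  | zero => simp
  | succ m ih =>
    rw [zpow_add_one, Units.val_mul, ih, hu, add_zsmul, one_zsmul, mul_add, add_mul (1 : A) _ x,
      smul_mul_assoc, hx]
    simp [add_assoc]
  | pred m ih =>
    rw [zpow_sub_one, Units.val_mul, ih, hinv, sub_zsmul, one_zsmul, mul_sub, add_mul (1 : A) _ x,
      smul_mul_assoc, hx]
    simp [sub_eq_add_neg, add_assoc]

theorem magnusHom_value_zpow {w : ℕ} {u : FreeMagma (Fin q)} (hw : 0 < w) (hu : w ≤ u.length)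
    (m : ℤ) : (magnusHom q (w + 1) (value FreeGroup.of u ^ m) : TruncRing q (w + 1)) =
      1 + m • lieValue (truncVar q (w + 1)) u := by
  have hJ := isMulFiltration_truncFiltration q (w + 1)
  have hl := hJ.lieValue_mem truncVar_mem u
  rw [map_zpow, magnusHom_value]
  -- The square has degree at least `2w`, which exceeds `w` because `w > 0`.
  refine val_zpow_of_mul_self_eq_zero ?_
    (eq_zero_of_mem_truncFiltration (by omega) (hJ.mul_mem hl hl)) m
  have h := eq_zero_of_mem_truncFiltration (by omega)
    (hJ.value_sub_one_sub_lieValue_mem truncVar_mem (fun i => val_truncUnit i) u)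
  rw [sub_sub, sub_eq_zero] at h
  exact h

theorem lieValue_truncVar_eq_zero {w : ℕ} {u : FreeMagma (Fin q)} (hu : w < u.length) :
    lieValue (truncVar q (w + 1)) u = 0 :=
  eq_zero_of_mem_truncFiltration hu
    ((isMulFiltration_truncFiltration q (w + 1)).lieValue_mem truncVar_mem u)

end TruncFiltration

/-! ### Uniqueness of exponents -/

section Uniqueness

variable {q : ℕ} {b : ℕ → FreeMagma (Fin q)}

/-- Modulo `𝔨 ^ (w + 1)`, factors lighter than `w` agree, heavier ones are 1, and those of weight
`w` contribute additively, since multiplication by group elements fixes degree `w`. -/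
theorem magnusHom_powProd_eq_add_sum {w : ℕ} (hw : 0 < w) {N : ℕ} {μ ν : Fin N → ℤ}
    (h : ∀ j : Fin N, (b j).length < w → μ j = ν j) :
    (magnusHom q (w + 1) (powProd (fun j => value FreeGroup.of (b j)) μ) : TruncRing q (w + 1)) =
      magnusHom q (w + 1) (powProd (fun j => value FreeGroup.of (b j)) ν) +
        ∑ j with (b (Fin.val j)).length = w,
          (μ j - ν j) • lieValue (truncVar q (w + 1)) (b j) := by
  have hJ := isMulFiltration_truncFiltration q (w + 1)
  have hl : ∀ j, (b j).length = w →
      lieValue (truncVar q (w + 1)) (b j) ∈ truncFiltration q (w + 1) w := fun j hj => by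
    simpa only [hj] using hJ.lieValue_mem truncVar_mem (b j)
  induction N with
  | zero => simp [powProd_zero]
  | succ N ih =>
    specialize ih (μ := fun j => μ j.castSucc) (ν := fun j => ν j.castSucc) fun j hj => h _ hj
    have hS : ∑ j with (b (Fin.val (n := N) j)).length = w,
        (μ j.castSucc - ν j.castSucc) • lieValue (truncVar q (w + 1)) (b j) ∈
          truncFiltration q (w + 1) w :=
      sum_mem fun j hj => zsmul_mem (hl j (Finset.mem_filter.1 hj).2) _
    rw [Finset.sum_filter] at hS ih ⊢
    set P := (magnusHom q (w + 1) (powProd (fun j => value FreeGroup.of (b j))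
      fun j => ν j.castSucc) : TruncRing q (w + 1))
    have hlast : P * magnusHom q (w + 1) (value FreeGroup.of (b N) ^ μ (Fin.last N)) =
        P * magnusHom q (w + 1) (value FreeGroup.of (b N) ^ ν (Fin.last N)) +
          if (b N).length = w then
            (μ (Fin.last N) - ν (Fin.last N)) • lieValue (truncVar q (w + 1)) (b N) else 0 := by
      rcases lt_trichotomy (b N).length w with hN | hN | hN
      · rw [h (Fin.last N) hN, if_neg hN.ne, add_zero]
      · rw [magnusHom_value_zpow hw hN.ge, magnusHom_value_zpow hw hN.ge, if_pos hN, mul_add,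
          mul_add, mul_smul_comm, mul_smul_comm, (magnusHom_mul_eq_of_mem (hl N hN) _).2, sub_smul]
        abel
      · rw [magnusHom_value_zpow hw hN.le, magnusHom_value_zpow hw hN.le, if_neg hN.ne',
          lieValue_truncVar_eq_zero hN]
        simp
    rw [powProd_succ, powProd_succ, map_mul, map_mul, Units.val_mul, Units.val_mul, ih, add_mul,
      (magnusHom_mul_eq_of_mem hS _).1, hlast, Fin.sum_univ_castSucc]
    simp only [Fin.val_castSucc, Fin.val_last]
    abel

theorem IsBasicSequence.eq_of_magnusHom_powProd_eq (hb : IsBasicSequence b) {n N : ℕ}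
    {μ ν : Fin N → ℤ}
    (h : magnusHom q n (powProd (fun j => value FreeGroup.of (b j)) μ) =
      magnusHom q n (powProd (fun j => value FreeGroup.of (b j)) ν))
    (j : Fin N) (hj : (b j).length < n) : μ j = ν j := by
  obtain ⟨w, hw⟩ : ∃ w, (b j).length = w := ⟨_, rfl⟩
  induction w using Nat.strong_induction_on generalizing j with
  | _ w ih =>
    have hwn : w + 1 ≤ n := hw ▸ hj
    have hw0 : 0 < w := hw ▸ (b j).length_pos
    have hsum := magnusHom_powProd_eq_add_sum (b := b) hw0 (μ := μ) (ν := ν)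
      fun i hi => ih _ hi i (hi.trans hwn) rfl
    -- Equality modulo `𝔨 ^ n` is weakened to level `w + 1`, where weight `w` is the top degree.
    have heq : magnusHom q (w + 1) (powProd (fun j => value FreeGroup.of (b j)) μ) =
        magnusHom q (w + 1) (powProd (fun j => value FreeGroup.of (b j)) ν) := by
      rw [← div_eq_one, ← map_div] at h ⊢
      exact ker_magnusHom_antitone q hwn h
    rw [heq, left_eq_add] at hsum
    have hli := (hb.linearIndependent_lieValue_truncVar w).comp
      (fun i : {i : Fin N // (b i).length = w} => ⟨i.1, i.2⟩)
      (fun i i' h => Subtype.ext (Fin.ext (congrArg Subtype.val h)))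
    rw [Fintype.linearIndependent_iff] at hli
    refine sub_eq_zero.1 (hli (fun i => μ i - ν i) ?_ ⟨j, hw⟩)
    rw [← hsum]
    exact (Finset.sum_subtype (Finset.univ.filter fun i : Fin N => (b i).length = w) (by simp)
      fun i => (μ i - ν i) • lieValue (truncVar q (w + 1)) (b i)).symm

end Uniqueness

/-! ### The kernel, the isomorphism and the normal form -/

section NormalForm

variable {q n : ℕ} {b : ℕ → FreeMagma (Fin q)}

theorem value_mk_eq_one (u : FreeMagma (Fin q)) (hu : n ≤ u.length) :
    value (fun i => (QuotientGroup.mk (FreeGroup.of i) :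
      FreeGroup (Fin q) ⧸ gamma (FreeGroup (Fin q)) n)) u = 1 := by
  refine (map_value (QuotientGroup.mk' (gamma (FreeGroup (Fin q)) n)) FreeGroup.of u).symm.trans ?_
  rw [QuotientGroup.mk'_apply, QuotientGroup.eq_one_iff]
  exact gamma_antitone hu (value_mem_gamma _ u)

theorem IsBasicSequence.exists_mk_eq_powProd (hb : IsBasicSequence b) {N : ℕ}
    (hN : n ≤ (b N).length) (g : FreeGroup (Fin q)) :
    ∃ μ : Fin N → ℤ, (g : FreeGroup (Fin q) ⧸ gamma (FreeGroup (Fin q)) n) =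
      QuotientGroup.mk (powProd (fun j => value FreeGroup.of (b j)) μ) := by
  have hg : (g : FreeGroup (Fin q) ⧸ gamma (FreeGroup (Fin q)) n) ∈ Subgroup.closure
      (Set.range fun i => (QuotientGroup.mk (FreeGroup.of i) :
        FreeGroup (Fin q) ⧸ gamma (FreeGroup (Fin q)) n)) := by
    have h := Subgroup.mem_map_of_mem (QuotientGroup.mk' (gamma (FreeGroup (Fin q)) n))
      (show g ∈ Subgroup.closure (Set.range FreeGroup.of) by
        rw [FreeGroup.closure_range_of]; trivial)
    rwa [MonoidHom.map_closure, ← Set.range_comp] at h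
  obtain ⟨μ, hμ⟩ := hb.exists_eq_powProd value_mk_eq_one hg hN
  refine ⟨μ, hμ.trans ?_⟩
  rw [← QuotientGroup.mk'_apply, map_powProd]
  simp only [map_value, QuotientGroup.mk'_apply]

theorem ker_magnusHom [Nontrivial (Fin q)] (hn : 0 < n) :
    (magnusHom q n).ker = gamma (FreeGroup (Fin q)) n := by
  refine le_antisymm (fun g hg => ?_) (gamma_le_ker_magnusHom hn)
  -- An auxiliary sequence; any one serves.
  obtain ⟨b, hb⟩ := exists_isBasicSequence (α := Fin q)
  obtain ⟨N, hN⟩ := hb.exists_lt_iff_length_lt n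
  obtain ⟨μ, hμ⟩ := hb.exists_mk_eq_powProd (not_lt.1 fun h => lt_irrefl _ ((hN N).2 h)) g
  have hμ' := gamma_le_ker_magnusHom hn (QuotientGroup.eq.1 hμ)
  rw [MonoidHom.mem_ker, map_mul, map_inv, hg, inv_one, one_mul] at hμ'
  have hz : powProd (fun j => value FreeGroup.of (b j)) (0 : Fin N → ℤ) =
      (1 : FreeGroup (Fin q)) := by simp [powProd]
  have h0 : μ = 0 := funext fun j => hb.eq_of_magnusHom_powProd_eq (n := n) (ν := 0)
    (by rw [hμ', hz, map_one]) j ((hN j).1 j.2)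
  rwa [h0, hz, QuotientGroup.mk_one, QuotientGroup.eq_one_iff] at hμ

theorem range_magnusHom (q n : ℕ) : (magnusHom q n).range = truncGroup q n :=
  FreeGroup.range_lift_eq_closure

/-- The isomorphism of `F / γ_n(F)` with the group generated by the `1 + x_i`. -/
noncomputable def magnusEquiv [Nontrivial (Fin q)] (hn : 0 < n) :
    FreeGroup (Fin q) ⧸ gamma (FreeGroup (Fin q)) n ≃* truncGroup q n :=
  (QuotientGroup.quotientMulEquivOfEq (ker_magnusHom hn).symm).trans
    ((QuotientGroup.quotientKerEquivRange (magnusHom q n)).trans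
      (MulEquiv.subgroupCongr (range_magnusHom q n)))

theorem magnusEquiv_of [Nontrivial (Fin q)] (hn : 0 < n) (i : Fin q) :
    magnusEquiv hn (QuotientGroup.mk (FreeGroup.of i)) = truncGen q n i :=
  Subtype.ext (magnusHom_of i)

theorem magnusEquiv_powProd [Nontrivial (Fin q)] (hn : 0 < n) {N : ℕ} (μ : Fin N → ℤ) :
    magnusEquiv hn (QuotientGroup.mk (powProd (fun j => value FreeGroup.of (b j)) μ)) =
      powProd (fun j => value (truncGen q n) (b j)) μ := by
  have h := map_powProd ((magnusEquiv hn).toMonoidHom.comp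
    (QuotientGroup.mk' (gamma (FreeGroup (Fin q)) n))) (fun j => value FreeGroup.of (b j)) μ
  simp only [map_value] at h
  refine h.trans ?_
  simp only [MonoidHom.comp_apply, QuotientGroup.mk'_apply, MulEquiv.coe_toMonoidHom,
    magnusEquiv_of]

theorem IsBasicSequence.existsUnique_mk_eq_powProd (hb : IsBasicSequence b) (hn : 0 < n) {N : ℕ}
    (hN : ∀ j, j < N ↔ (b j).length < n)
    (g : FreeGroup (Fin q) ⧸ gamma (FreeGroup (Fin q)) n) :
    ∃! μ : Fin N → ℤ, g = QuotientGroup.mk (powProd (fun j => value FreeGroup.of (b j)) μ) := by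
  induction g using QuotientGroup.induction_on with | H g =>
  obtain ⟨μ, hμ⟩ := hb.exists_mk_eq_powProd (not_lt.1 fun h => lt_irrefl _ ((hN N).2 h)) g
  refine ⟨μ, hμ, fun ν hν => funext fun j =>
    hb.eq_of_magnusHom_powProd_eq (n := n) ?_ j ((hN j).1 j.2)⟩
  have h := gamma_le_ker_magnusHom hn (QuotientGroup.eq.1 (hμ.symm.trans hν))
  rw [MonoidHom.mem_ker, map_mul, map_inv, inv_mul_eq_one] at h
  exact h.symm

end NormalForm

/-! ### The lower central factors -/

section Factors

variable {q w : ℕ} {b : ℕ → FreeMagma (Fin q)}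

theorem value_mem_gamma_of_le {α G : Type*} [Group G] (y : α → G) {u : FreeMagma α}
    (hu : w ≤ u.length) : value y u ∈ gamma G w :=
  gamma_antitone hu (value_mem_gamma y u)

/-- The class in `γ_w / γ_{w+1}` of an expression of weight `w`, in additive notation. -/
def gammaClass (b : ℕ → FreeMagma (Fin q)) (w : ℕ) (j : {j : ℕ // (b j).length = w}) :
    Additive (GammaQuot (FreeGroup (Fin q)) w) :=
  Additive.ofMul (QuotientGroup.mk
    ⟨value FreeGroup.of (b j), value_mem_gamma_of_le FreeGroup.of j.2.ge⟩)

/-- The map `g ↦ g - 1` from `γ_w / γ_{w+1}` to the truncated free associative ring. -/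
noncomputable def gammaQuotHom (q : ℕ) {w : ℕ} (hw : 0 < w) :
    Additive (GammaQuot (FreeGroup (Fin q)) w) →+ TruncRing q (w + 1) :=
  MonoidHom.toAdditiveLeft (QuotientGroup.lift _
    { toFun := fun g => Multiplicative.ofAdd ((magnusHom q (w + 1) g.1 : TruncRing q (w + 1)) - 1)
      map_one' := by simp
      map_mul' := fun g h => by
        have hg : (magnusHom q (w + 1) g.1 : TruncRing q (w + 1)) - 1 ∈
            truncFiltration q (w + 1) w :=
          (isMulFiltration_truncFiltration q (w + 1)).gamma_le_comap _
            magnusHom_mem_unitsSubgroup hw g.2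
        -- Since `(g - 1)h = g - 1`, one gets `gh - 1 = (g - 1) + (h - 1)`.
        have h1 := (magnusHom_mul_eq_of_mem hg h.1).1
        rw [← ofAdd_add, Subgroup.coe_mul, map_mul, Units.val_mul]
        congr 1
        rw [sub_mul, one_mul, sub_eq_iff_eq_add] at h1
        rw [h1]
        abel }
    fun g hg => by
      have h := gamma_le_ker_magnusHom w.succ_pos (Subgroup.mem_subgroupOf.1 hg)
      rw [MonoidHom.mem_ker] at h
      simp [h])

theorem gammaQuotHom_gammaClass (hw : 0 < w) (j : {j : ℕ // (b j).length = w}) :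
    gammaQuotHom q hw (gammaClass b w j) = lieValue (truncVar q (w + 1)) (b j) := by
  have h := magnusHom_value_zpow (q := q) hw j.2.ge 1
  rw [zpow_one, one_zsmul] at h
  change (magnusHom q (w + 1) (value FreeGroup.of (b j)) : TruncRing q (w + 1)) - 1 = _
  rw [h, add_sub_cancel_left]

theorem IsBasicSequence.linearIndependent_gammaClass (hb : IsBasicSequence b) (hw : 0 < w) :
    LinearIndependent ℤ (gammaClass b w) := by
  refine LinearIndependent.of_comp (gammaQuotHom q hw).toIntLinearMap ?_
  have h : (gammaQuotHom q hw).toIntLinearMap ∘ gammaClass b w =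
      fun j : {j : ℕ // (b j).length = w} => lieValue (truncVar q (w + 1)) (b j) :=
    funext fun j => gammaQuotHom_gammaClass hw j
  rw [h]
  exact hb.linearIndependent_lieValue_truncVar w

theorem exists_mk_powProd_mem_span_gammaClass {N : ℕ} {μ : Fin N → ℤ}
    (hN : ∀ j : Fin N, (b j).length ≤ w) (hμ : ∀ j : Fin N, (b j).length < w → μ j = 0) :
    ∃ h : powProd (fun j => value FreeGroup.of (b j)) μ ∈ gamma (FreeGroup (Fin q)) w,
      Additive.ofMul (QuotientGroup.mk ⟨_, h⟩ : GammaQuot (FreeGroup (Fin q)) w) ∈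
        Submodule.span ℤ (Set.range (gammaClass b w)) := by
  induction N with
  | zero =>
    have h1 : powProd (fun j => value FreeGroup.of (b j)) μ = (1 : FreeGroup (Fin q)) :=
      powProd_zero _ _
    simp only [h1]
    exact ⟨one_mem _, zero_mem _⟩
  | succ N ih =>
    obtain ⟨h, hmem⟩ := ih (μ := fun j => μ j.castSucc) (fun j => hN j.castSucc)
      fun j hj => hμ j.castSucc hj
    rw [powProd_succ]
    rcases (hN (Fin.last N)).lt_or_eq with hl | hl
    · simp only [hμ _ hl, zpow_zero, mul_one]
      exact ⟨h, hmem⟩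
    · refine ⟨mul_mem h (zpow_mem (value_mem_gamma_of_le _ (ge_of_eq hl)) _), ?_⟩
      exact add_mem hmem (Submodule.smul_mem _ (μ (Fin.last N))
        (Submodule.subset_span ⟨⟨N, hl⟩, rfl⟩))

theorem IsBasicSequence.span_gammaClass (hb : IsBasicSequence b) (hw : 0 < w) :
    ⊤ ≤ Submodule.span ℤ (Set.range (gammaClass b w)) := by
  rintro x -
  obtain ⟨⟨g, hg⟩, hx⟩ := QuotientGroup.mk_surjective x.toMul
  -- The normal form is taken modulo `γ_{w+1}`. It lies in `γ_w`, so uniqueness at level `w` kills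
  -- all exponents of weight below `w`.
  obtain ⟨N, hN⟩ := hb.exists_lt_iff_length_lt (w + 1)
  obtain ⟨μ, hμ⟩ := hb.exists_mk_eq_powProd (not_lt.1 fun h => lt_irrefl _ ((hN N).2 h)) g
  have hgμ := QuotientGroup.eq.1 hμ
  have hz : powProd (fun j => value FreeGroup.of (b j)) (0 : Fin N → ℤ) =
      (1 : FreeGroup (Fin q)) := by simp [powProd]
  have hPw : powProd (fun j => value FreeGroup.of (b j)) μ ∈ gamma (FreeGroup (Fin q)) w := by
    have := mul_mem hg (gamma_antitone w.le_succ hgμ)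
    rwa [mul_inv_cancel_left] at this
  obtain ⟨h, hmem⟩ := exists_mk_powProd_mem_span_gammaClass (w := w) (b := b) (μ := μ)
    (fun j => Nat.lt_succ_iff.1 ((hN j).1 j.2))
    (hb.eq_of_magnusHom_powProd_eq (n := w) (ν := 0) (by
      rw [hz, map_one]
      exact gamma_le_ker_magnusHom hw hPw))
  convert hmem using 1
  refine hx.symm.trans (QuotientGroup.eq.2 ?_)
  exact hgμ

end Factors

end BasicComm

theorem theorem5p6 (q : ℕ) (hq : 2 ≤ q) :
    -- `F / γ_n(F) ≅ H` and the normal form of the elements of both groups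
    (∀ n : ℕ, 0 < n →
      (∃ φ : FreeGroup (Fin q) ⧸ BasicComm.gamma (FreeGroup (Fin q)) n ≃*
          BasicComm.truncGroup q n,
        ∀ i : Fin q, φ (QuotientGroup.mk (FreeGroup.of i)) = BasicComm.truncGen q n i) ∧
      ∀ b : ℕ → FreeMagma (Fin q), BasicComm.IsBasicSequence b →
        ∃ N : ℕ, (∀ j : ℕ, j < N ↔ (b j).length < n) ∧
          (∀ h : BasicComm.truncGroup q n, ∃! μ : Fin N → ℤ,
            h = BasicComm.powProd
              (fun j => BasicComm.value (BasicComm.truncGen q n) (b j)) μ) ∧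
          (∀ g : FreeGroup (Fin q) ⧸ BasicComm.gamma (FreeGroup (Fin q)) n,
            ∃! μ : Fin N → ℤ,
              g = QuotientGroup.mk (BasicComm.powProd
                (fun j => BasicComm.value FreeGroup.of (b j)) μ))) ∧
    -- `γ_w(F) / γ_{w+1}(F)` is free abelian on the basic commutators of weight `w`
    (∀ b : ℕ → FreeMagma (Fin q), BasicComm.IsBasicSequence b → ∀ w : ℕ, 0 < w →
      ∃ B : Module.Basis {j : ℕ // (b j).length = w} ℤ
          (Additive (BasicComm.GammaQuot (FreeGroup (Fin q)) w)),
        ∀ j : {j : ℕ // (b j).length = w}, ∃ hj : BasicComm.value FreeGroup.of (b j) ∈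
            BasicComm.gamma (FreeGroup (Fin q)) w,
          B j = Additive.ofMul (QuotientGroup.mk ⟨BasicComm.value FreeGroup.of (b j), hj⟩)) := by
  have : Nontrivial (Fin q) := Fin.nontrivial_iff_two_le.2 hq
  refine ⟨fun n hn => ⟨⟨BasicComm.magnusEquiv hn, BasicComm.magnusEquiv_of hn⟩, fun b hb => ?_⟩,
    fun b hb w hw => ?_⟩
  · obtain ⟨N, hN⟩ := hb.exists_lt_iff_length_lt n
    refine ⟨N, hN, fun h => ?_, hb.existsUnique_mk_eq_powProd hn hN⟩
    refine (existsUnique_congr fun μ => ?_).mp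
      (hb.existsUnique_mk_eq_powProd hn hN ((BasicComm.magnusEquiv hn).symm h))
    rw [MulEquiv.symm_apply_eq, BasicComm.magnusEquiv_powProd]
  · refine ⟨Module.Basis.mk (hb.linearIndependent_gammaClass hw) (hb.span_gammaClass hw),
      fun j => ⟨BasicComm.value_mem_gamma_of_le _ j.2.ge, ?_⟩⟩
    rw [Module.Basis.mk_apply]
    rfl
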